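/- Let $q>2$ be an integer, let $\mathcal F$ be an alphabet of size $q$, and put $\theta=1-\frac1q$. For real $d$ let $A_q(n,d)$ be the maximum size of a code $C\subseteq\mathcal F^n$ in which any two distinct words have Hamming distance at least $d$, and let \[ \alpha(x)=\limsup_{n\to\infty} n^{-1}\log_q A_q(n,xn). \] Let $H_q(x)=x\log_q\frac{q-1}{x}+(1-x)\log_q\frac1{1-x}$ for $x\in[0,1]$ (with $H_q(0)=0$ and $H_q(1)=\log_q(q-1)$). Let $\alpha_E(x)=1-H_q\bigl(\theta(1-\sqrt{1-x/\theta})\bigr)$ and $\alpha_P(x)=1-x/\theta$, $x\in[0,\theta]$, be the asymptotic Elias and Plotkin bounds. Define \[ \alpha_{EP}(x)=\begin{cases} 1-H_q\bigl(\theta-\sqrt{\theta^2-x\theta}\bigr) & \text{if } x\in\bigl[0,\tfrac{2q-3}{q(q-1)}\bigr],\\[2pt] (\theta-x)\,\tfrac{(q-1)H_q(1)}{q-2} & \text{if } x\in\bigl[\tfrac{2q-3}{q(q-1)},\theta\bigr].\end{cases} \] The two formulas agree at the common endpoint, and $\alpha(x)\le\alpha_{EP}(x)$ for all $x\in[0,\theta]$.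 The bound $\alpha_{EP}$ improves the Elias and the Plotkin bounds: $\alpha_{EP}(x)\le\alpha_E(x)$ and $\alpha_{EP}(x)\le\alpha_P(x)$ for all $x\in[0,\theta]$, and each of these two inequalities is strict for some $x\in[0,\theta]$. Moreover $\alpha_{EP}$ is convex ($\cup$-convex) and continuous on $[0,\theta]$, and continuously differentiable on $(0,\theta]$ (with the one-sided derivative at $\theta$). -/

import Mathlib

open Set Filter

noncomputable section

namespace QaryCode

/-- `C ⊆ Fⁿ` has minimum distance at least the real number `d`: any two distinct words of `C`
have Hamming distance at least `d`. -/
def HasMinDist {F : Type*} [DecidableEq F] {n : ℕ} (C : Finset (Fin n → F)) (d : ℝ) : Prop :=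
  ∀ u ∈ C, ∀ v ∈ C, u ≠ v → d ≤ (hammingDist u v : ℝ)

/-- The maximum size of a code in `Fⁿ` with minimum distance at least `d`.
For a finite alphabet the set of sizes is nonempty and bounded by `|F| ^ n`, so that the
supremum is a maximum. -/
def maxCodeSize (F : Type*) [Fintype F] [DecidableEq F] (n : ℕ) (d : ℝ) : ℕ :=
  sSup {M : ℕ | ∃ C : Finset (Fin n → F), HasMinDist C d ∧ C.card = M}

/-- The asymptotic information rate function `α`, for codes over the alphabet `F`.
For `|F| ≥ 2` the sequence takes values in `[0, 1]`. -/
def asymptoticRate (F : Type*) [Fintype F] [DecidableEq F] (x : ℝ) : ℝ :=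
  limsup (fun n : ℕ => (n : ℝ)⁻¹ * Real.logb (Fintype.card F) (maxCodeSize F n (x * n))) atTop

/-- The `q`-ary entropy function on `[0, 1]`, with logarithms to the base `q`. The conventions
`a / 0 = 0` and `0 * a = 0` give the usual values `0` at `0` and `log_q (q - 1)` at `1`. -/
def entropy (q : ℕ) (x : ℝ) : ℝ :=
  x * Real.logb q ((q - 1) / x) + (1 - x) * Real.logb q (1 / (1 - x))

/-- `θ = 1 - 1 / q`. -/
def theta (q : ℕ) : ℝ := 1 - (q : ℝ)⁻¹

/-- The asymptotic Hamming bound. -/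
def hammingBound (q : ℕ) (x : ℝ) : ℝ := 1 - entropy q (x / 2)

/-- The asymptotic Elias bound on `[0, θ]`. -/
def eliasBound (q : ℕ) (x : ℝ) : ℝ :=
  hammingBound q (2 * theta q * (1 - √(1 - x / theta q)))

/-- The asymptotic Plotkin bound on `[0, θ]`: the line through `(0, 1)` and `(θ, 0)`. -/
def plotkinBound (q : ℕ) (x : ℝ) : ℝ := 1 - x / theta q

/-- The point `(2q - 3) / (q (q - 1))` at which the two pieces of the hybrid bound meet. -/
def crossover (q : ℕ) : ℝ := (2 * q - 3) / (q * (q - 1))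

/-- The hybrid Elias-Plotkin bound on `[0, θ]`. -/
def eliasPlotkinBound (q : ℕ) (x : ℝ) : ℝ :=
  if x ≤ crossover q then 1 - entropy q (theta q - √(theta q ^ 2 - x * theta q))
  else (theta q - x) * ((q - 1) * entropy q 1 / (q - 2))

end QaryCode

end

open QaryCode

open scoped Topology

/-! ### Pairs of distinct letters in a coordinate -/

section Pairs

variable {α F : Type*} [Fintype F] [DecidableEq F]

/-! The upper bound on the rate comes from one family of anticodes: a sphere of radius `w` in a set
`T` of `m` coordinates, times the full space in the other `n - m`. Averaging over centres reduces a
code to its part in one anticode. There, Cauchy–Schwarz in each coordinate bounds the mean distance,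
Elias-like on `T` and Plotkin-like off `T` (`card_mul_sub_le_of_sphere`). If `d` exceeds this mean
by a fixed fraction of `n`, that part has bounded size. With `m ≈ μn` and `w ≈ ωm` this gives `α(x)
≤ μ(1 - H(ω))` whenever `μ(2ω - ω²/θ) + (1 - μ)θ ≤ x` (`asymptoticRate_le`). Taking `μ = 1` gives
the Elias curve; taking `ω = 1/q` with varying `μ` gives the segment from its point at the crossover
to `(θ, 0)`.

The analysis uses the Elias radius `y`, for which `(θ - y)² = θ(θ - x)`. Since `log (q - 1) = -logit
θ`, the slope of the Elias curve is, up to a negative constant factor, the difference quotient of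
`logit` between `y` and `θ`. As `logit` is odd about `1/2` and convex on `(0, 1/2]`, this quotient
decreases for `y ≤ 1 - θ = 1/q` (`antitoneOn_slope_logit`), whence convexity. At `y = 1/q` the slope
equals that of the line, so the pieces join tangentially. The Plotkin bound is a chord of this
convex function. Elias minus the line is a function of `y` symmetric under `y ↦ 1 - y`, zero at
`1/q` and increasing up to `1/2` (`strictMonoOn_eliasGap`). -/

theorem sum_card_fiber (K : Finset α) (g : α → F) :
    ∑ f : F, ((K.filter (fun a => g a = f)).card : ℝ) = K.card := by
  have := Finset.card_eq_sum_card_fiberwise (f := g) (s := K) (t := Finset.univ) (by simp)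
  rw [this]
  push_cast
  rfl

theorem sum_pairs_ne (K : Finset α) (g : α → F) :
    ∑ a ∈ K, ∑ b ∈ K, (if g a ≠ g b then (1 : ℝ) else 0) =
      (K.card : ℝ) ^ 2 - ∑ f : F, ((K.filter (fun a => g a = f)).card : ℝ) ^ 2 := by
  have h1 : ∀ a ∈ K, ∑ b ∈ K, (if g a ≠ g b then (1 : ℝ) else 0) =
      K.card - ∑ b ∈ K, (if g b = g a then (1 : ℝ) else 0) := by
    intro a _
    rw [eq_sub_iff_add_eq, ← Finset.sum_add_distrib, Finset.card_eq_sum_ones]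
    push_cast
    refine Finset.sum_congr rfl fun b _ => ?_
    by_cases h : g a = g b
    · simp [h]
    · simp [h, Ne.symm h]
  rw [Finset.sum_congr rfl h1, Finset.sum_sub_distrib]
  congr 1
  · simp [sq]
  · have h2 : ∀ a ∈ K, ∑ b ∈ K, (if g b = g a then (1 : ℝ) else 0) =
        ∑ f : F, if g a = f then ((K.filter (fun b => g b = f)).card : ℝ) else 0 := by
      intro a _
      rw [Finset.sum_ite_eq Finset.univ (g a)]
      simp
    rw [Finset.sum_congr rfl h2, Finset.sum_comm]
    refine Finset.sum_congr rfl fun f _ => ?_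
    rw [← Finset.sum_filter]
    simp [sq]

theorem sum_pairs_ne_le (K : Finset α) (g : α → F) (hF : 0 < Fintype.card F) :
    ∑ a ∈ K, ∑ b ∈ K, (if g a ≠ g b then (1 : ℝ) else 0) ≤
      theta (Fintype.card F) * (K.card : ℝ) ^ 2 := by
  rw [sum_pairs_ne]
  have h := sq_sum_le_card_mul_sum_sq (s := (Finset.univ : Finset F))
    (f := fun f => ((K.filter (fun a => g a = f)).card : ℝ))
  rw [sum_card_fiber, Finset.card_univ] at h
  have hq : (0 : ℝ) < Fintype.card F := by exact_mod_cast hF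
  unfold theta
  have : (Fintype.card F : ℝ)⁻¹ * (K.card : ℝ) ^ 2 ≤
      ∑ f : F, ((K.filter (fun a => g a = f)).card : ℝ) ^ 2 := by
    rw [inv_mul_le_iff₀ hq]
    exact h
  linarith

/-- Cauchy–Schwarz is applied only to the `q - 1` letters other than `u`, the count of `u` being
known exactly; `1 + 1/(q - 1) = 1/θ` produces the final form. -/
theorem sum_pairs_ne_le_of_letter (K : Finset α) (g : α → F) (hF : 1 < Fintype.card F) (u : F) :
    ∑ a ∈ K, ∑ b ∈ K, (if g a ≠ g b then (1 : ℝ) else 0) ≤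
      2 * K.card * ((K.filter (fun a => g a ≠ u)).card : ℝ) -
        ((K.filter (fun a => g a ≠ u)).card : ℝ) ^ 2 / theta (Fintype.card F) := by
  rw [sum_pairs_ne]
  set s : ℝ := ((K.filter (fun a => g a ≠ u)).card : ℝ) with hs
  have hq : (1 : ℝ) < Fintype.card F := by exact_mod_cast hF
  have hsum : ((K.filter (fun a => g a = u)).card : ℝ) + s = K.card := by
    rw [hs]
    exact_mod_cast Finset.card_filter_add_card_filter_not (s := K) (fun a => g a = u)
  have h1 := sum_card_fiber K g
  rw [← Finset.add_sum_erase _ _ (Finset.mem_univ u)] at h1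
  rw [← Finset.add_sum_erase _ _ (Finset.mem_univ u)]
  have h := sq_sum_le_card_mul_sum_sq (s := (Finset.univ : Finset F).erase u)
    (f := fun f => ((K.filter (fun a => g a = f)).card : ℝ))
  have h2 : ∑ f ∈ Finset.univ.erase u, ((K.filter (fun a => g a = f)).card : ℝ) = s := by
    linarith
  have h3 : (((Finset.univ : Finset F).erase u).card : ℝ) = Fintype.card F - 1 := by
    rw [Finset.card_erase_of_mem (Finset.mem_univ u), Finset.card_univ,
      Nat.cast_sub hF.le]
    simp
  rw [h2, h3] at h
  have h4 : s ^ 2 / (Fintype.card F - 1) ≤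
      ∑ f ∈ Finset.univ.erase u, ((K.filter (fun a => g a = f)).card : ℝ) ^ 2 := by
    rw [div_le_iff₀ (by linarith)]
    linarith
  have h5 : s ^ 2 / theta (Fintype.card F) = s ^ 2 + s ^ 2 / (Fintype.card F - 1) := by
    unfold theta
    have : (Fintype.card F : ℝ) - 1 ≠ 0 := by linarith
    field_simp
    ring
  rw [h5]
  have h6 : ((K.filter (fun a => g a = u)).card : ℝ) = K.card - s := by linarith
  rw [h6]
  nlinarith

end Pairs

/-! ### Anticodes: a sphere in some coordinates times the full space in the others -/

section Anticode

theorem hammingDist_eq_sum {ι F : Type*} [Fintype ι] [DecidableEq F] (a b : ι → F) :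
    (hammingDist a b : ℝ) = ∑ i, if a i ≠ b i then (1 : ℝ) else 0 := by
  rw [hammingDist, Finset.sum_boole]

variable {ι F : Type*} [Fintype ι] [DecidableEq ι] [Fintype F] [DecidableEq F]

/-- A code whose words all differ from `u` in exactly `w` of the coordinates in `T` is small
when its minimum distance exceeds the average distance in such a set. -/
theorem card_mul_sub_le_of_sphere (hF : 1 < Fintype.card F) (T : Finset ι) (w : ℕ) (u : ι → F)
    (K : Finset (ι → F)) (hK : ∀ v ∈ K, (T.filter (fun i => v i ≠ u i)).card = w) {d : ℝ}
    (hd : 0 ≤ d) (hdist : ∀ a ∈ K, ∀ b ∈ K, a ≠ b → d ≤ (hammingDist a b : ℝ)) :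
    (K.card : ℝ) * (d - (2 * w - (w : ℝ) ^ 2 / (T.card * theta (Fintype.card F)) +
      (Fintype.card ι - T.card) * theta (Fintype.card F))) ≤ d := by
  set θ := theta (Fintype.card F) with hθ
  have hq : (1 : ℝ) < Fintype.card F := by exact_mod_cast hF
  have hθ0 : 0 < θ := by
    rw [hθ, theta, sub_pos]
    exact inv_lt_one_of_one_lt₀ hq
  set M : ℝ := (K.card : ℝ) with hM
  have hM0 : 0 ≤ M := by positivity
  set S : ℝ := ∑ a ∈ K, ∑ b ∈ K, (hammingDist a b : ℝ) with hS
  have hlow : M * (M - 1) * d ≤ S := by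
    have : ∀ a ∈ K, (M - 1) * d ≤ ∑ b ∈ K, (hammingDist a b : ℝ) := by
      intro a ha
      rw [← Finset.add_sum_erase _ _ ha, hammingDist_self]
      have h1 := Finset.card_nsmul_le_sum (K.erase a) (fun b => (hammingDist a b : ℝ)) d
        (fun b hb => hdist a ha b (Finset.mem_of_mem_erase hb) (Finset.ne_of_mem_erase hb).symm)
      rw [Finset.card_erase_of_mem ha, nsmul_eq_mul,
        Nat.cast_sub (Finset.card_pos.2 ⟨a, ha⟩)] at h1
      simpa using h1
    have h2 := Finset.card_nsmul_le_sum K _ _ this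
    rw [nsmul_eq_mul] at h2
    linarith
  set s : ι → ℝ := fun i => ((K.filter (fun a => a i ≠ u i)).card : ℝ) with hs
  have hsw : ∑ i ∈ T, s i = M * w := by
    have h1 : ∀ i ∈ T, s i = ∑ a ∈ K, if a i ≠ u i then (1 : ℝ) else 0 := by
      intro i _
      rw [Finset.sum_boole]
    rw [Finset.sum_congr rfl h1, Finset.sum_comm]
    have h2 : ∀ a ∈ K, (∑ i ∈ T, if a i ≠ u i then (1 : ℝ) else 0) = w := by
      intro a ha
      rw [← hK a ha]
      rw [Finset.sum_boole]
    rw [Finset.sum_congr rfl h2]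
    simp [hM]
  have hcs : (M * w) ^ 2 / (T.card * θ) ≤ ∑ i ∈ T, s i ^ 2 / θ := by
    rw [← Finset.sum_div, ← div_div]
    apply div_le_div_of_nonneg_right _ hθ0.le
    -- This form of the inequality also covers empty `T`, where the quotient is `0` by convention.
    apply div_le_of_le_mul₀ (by positivity) (Finset.sum_nonneg fun i _ => sq_nonneg _)
    rw [mul_comm (∑ i ∈ T, s i ^ 2), ← hsw]
    exact sq_sum_le_card_mul_sum_sq
  have hup : S ≤ M ^ 2 * (2 * w - (w : ℝ) ^ 2 / (T.card * θ) + (Fintype.card ι - T.card) * θ) := by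
    have h1 : S = ∑ i, ∑ a ∈ K, ∑ b ∈ K, if a i ≠ b i then (1 : ℝ) else 0 := by
      rw [hS, Finset.sum_comm]
      simp_rw [hammingDist_eq_sum]
      rw [Finset.sum_comm]
      conv_rhs => rw [Finset.sum_comm]
      refine Finset.sum_congr rfl fun a _ => ?_
      rw [Finset.sum_comm]
    rw [h1, ← Finset.sum_add_sum_compl T]
    have h2 : ∑ i ∈ T, ∑ a ∈ K, ∑ b ∈ K, (if a i ≠ b i then (1 : ℝ) else 0) ≤
        ∑ i ∈ T, (2 * M * s i - s i ^ 2 / θ) :=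
      Finset.sum_le_sum fun i _ => sum_pairs_ne_le_of_letter K (fun a => a i) hF (u i)
    have h3 : ∑ i ∈ Tᶜ, ∑ a ∈ K, ∑ b ∈ K, (if a i ≠ b i then (1 : ℝ) else 0) ≤
        ∑ i ∈ Tᶜ, θ * M ^ 2 :=
      Finset.sum_le_sum fun i _ => sum_pairs_ne_le K (fun a => a i) (by omega)
    rw [Finset.sum_const, nsmul_eq_mul, Finset.card_compl,
      Nat.cast_sub (Finset.card_le_univ T)] at h3
    rw [Finset.sum_sub_distrib, ← Finset.mul_sum, hsw] at h2
    have h4 : (M * w) ^ 2 / (T.card * θ) = M ^ 2 * ((w : ℝ) ^ 2 / (T.card * θ)) := by ring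
    nlinarith
  rcases hM0.eq_or_lt with h0 | h0
  · rw [← h0]; simpa using hd
  · have := hlow.trans hup
    have h5 : M * ((M - 1) * d) ≤
        M * (M * (2 * w - (w : ℝ) ^ 2 / (T.card * θ) + (Fintype.card ι - T.card) * θ)) := by
      nlinarith
    have := le_of_mul_le_mul_left h5 h0
    linarith

/-- These words form a box: `q - 1` letters are allowed on `W`, one on the rest of `T`, all `q` off
`T`. -/
theorem card_words_differing_exactly (T W : Finset ι) (hW : W ⊆ T) (c : ι → F) :
    (Finset.univ.filter (fun u : ι → F => T.filter (fun i => c i ≠ u i) = W)).card =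
      (Fintype.card F - 1) ^ W.card * Fintype.card F ^ (Fintype.card ι - T.card) := by
  have h1 : Finset.univ.filter (fun u : ι → F => T.filter (fun i => c i ≠ u i) = W) =
      Fintype.piFinset (fun i => if i ∈ W then Finset.univ.erase (c i)
        else if i ∈ T then {c i} else Finset.univ) := by
    ext u
    simp only [Finset.mem_filter, Finset.mem_univ, true_and, Fintype.mem_piFinset, Finset.ext_iff]
    refine forall_congr' fun i => ?_
    by_cases h : i ∈ W
    · simp [h, hW h, eq_comm]
    · by_cases h' : i ∈ T
      · simp [h, h', eq_comm]
      · simp [h, h']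
  rw [h1, Fintype.card_piFinset]
  have h2 : ∀ i, (if i ∈ W then Finset.univ.erase (c i)
        else if i ∈ T then {c i} else Finset.univ : Finset F).card =
      (if i ∈ W then Fintype.card F - 1 else 1) * (if i ∈ Tᶜ then Fintype.card F else 1) := by
    intro i
    by_cases h : i ∈ W
    · simp [h, hW h, Finset.card_erase_of_mem, Finset.card_univ]
    · by_cases h' : i ∈ T
      · simp [h, h']
      · simp [h, h', Finset.card_univ]
  rw [Finset.prod_congr rfl fun i _ => h2 i, Finset.prod_mul_distrib]
  simp only [Finset.prod_ite_mem, Finset.univ_inter, Finset.prod_const, Finset.card_compl]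

theorem card_sphere_prod_univ (T : Finset ι) (w : ℕ) (c : ι → F) :
    (Finset.univ.filter (fun u : ι → F => (T.filter (fun i => c i ≠ u i)).card = w)).card =
      T.card.choose w * ((Fintype.card F - 1) ^ w *
        Fintype.card F ^ (Fintype.card ι - T.card)) := by
  rw [Finset.card_eq_sum_card_fiberwise (f := fun u : ι → F => T.filter (fun i => c i ≠ u i))
    (t := T.powersetCard w)]
  · rw [← Finset.card_powersetCard, ← smul_eq_mul, ← Finset.sum_const]
    refine Finset.sum_congr rfl fun W hW => ?_
    rw [Finset.mem_powersetCard] at hW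
    rw [← hW.2, ← card_words_differing_exactly T W hW.1 c, Finset.filter_filter]
    congr 1
    ext u
    simp only [Finset.mem_filter, Finset.mem_univ, true_and]
    constructor
    · exact fun h => h.2
    · exact fun h => ⟨by rw [h], h⟩
  · intro u hu
    simp only [Finset.coe_filter, Finset.mem_univ, true_and, Set.mem_ofPred_eq] at hu
    simp only [Finset.mem_coe, Finset.mem_powersetCard]
    exact ⟨Finset.filter_subset _ _, hu⟩

/-- Double counting of the pairs of a codeword and a sphere that contains it. -/
theorem card_mul_choose_le (hF : 1 < Fintype.card F) (T : Finset ι) (w : ℕ)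
    (C : Finset (ι → F)) {d B : ℝ} (hd : 0 ≤ d)
    (hdist : ∀ a ∈ C, ∀ b ∈ C, a ≠ b → d ≤ (hammingDist a b : ℝ))
    (hB : d ≤ B * (d - (2 * w - (w : ℝ) ^ 2 / (T.card * theta (Fintype.card F)) +
      (Fintype.card ι - T.card) * theta (Fintype.card F))))
    (hpos : 0 < d - (2 * w - (w : ℝ) ^ 2 / (T.card * theta (Fintype.card F)) +
      (Fintype.card ι - T.card) * theta (Fintype.card F))) :
    (C.card : ℝ) * (T.card.choose w * ((Fintype.card F : ℝ) - 1) ^ w) ≤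
      (Fintype.card F : ℝ) ^ T.card * B := by
  have hdc := Finset.sum_card_bipartiteAbove_eq_sum_card_bipartiteBelow
    (s := C) (t := (Finset.univ : Finset (ι → F)))
    (fun c u => (T.filter (fun i => c i ≠ u i)).card = w)
  have h1 : ∀ c ∈ C, (Finset.bipartiteAbove
      (fun c u : ι → F => (T.filter (fun i => c i ≠ u i)).card = w) Finset.univ c).card =
      T.card.choose w * ((Fintype.card F - 1) ^ w *
        Fintype.card F ^ (Fintype.card ι - T.card)) := by
    intro c _
    exact card_sphere_prod_univ T w c
  rw [Finset.sum_congr rfl h1, Finset.sum_const, smul_eq_mul] at hdc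
  have h2 : ∀ u : ι → F, ((Finset.bipartiteBelow
      (fun c u : ι → F => (T.filter (fun i => c i ≠ u i)).card = w) C u).card : ℝ) ≤ B := by
    intro u
    have h3 := card_mul_sub_le_of_sphere hF T w u (Finset.bipartiteBelow
      (fun c u : ι → F => (T.filter (fun i => c i ≠ u i)).card = w) C u)
      (fun v hv => (Finset.mem_filter.1 hv).2) hd
      (fun a ha b hb => hdist a (Finset.mem_filter.1 ha).1 b (Finset.mem_filter.1 hb).1)
    exact le_of_mul_le_mul_right (h3.trans hB) hpos
  have h4 : (∑ u : ι → F, ((Finset.bipartiteBelow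
      (fun c u : ι → F => (T.filter (fun i => c i ≠ u i)).card = w) C u).card : ℝ)) ≤
      (Fintype.card F : ℝ) ^ Fintype.card ι * B := by
    refine (Finset.sum_le_card_nsmul _ _ B fun u _ => h2 u).trans_eq ?_
    rw [Finset.card_univ, Fintype.card_fun, nsmul_eq_mul]
    push_cast
    ring
  rw [← Nat.cast_sum, ← hdc] at h4
  have hq : (0 : ℝ) < Fintype.card F := by exact_mod_cast (by omega : 0 < Fintype.card F)
  have h5 : (Fintype.card F : ℝ) ^ Fintype.card ι =
      (Fintype.card F : ℝ) ^ T.card * (Fintype.card F : ℝ) ^ (Fintype.card ι - T.card) := by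
    rw [← pow_add, Nat.add_sub_cancel' (Finset.card_le_univ T)]
  rw [h5] at h4
  push_cast [Nat.cast_sub hF.le] at h4
  have h6 : (0 : ℝ) < (Fintype.card F : ℝ) ^ (Fintype.card ι - T.card) := by positivity
  refine le_of_mul_le_mul_right ?_ h6
  nlinarith

end Anticode

/-! ### The size of a sphere -/

section Choose

/-- The mode of the binomial distribution with mean `w` is `w`: consecutive terms have ratio `(m -
k) w : (k + 1)(m - w)`, at least `1` for `k < w` and at most `1` for `k ≥ w`. -/
theorem choose_mul_pow_le_mode (m w : ℕ) (hw : w ≤ m) (j : ℕ) (hj : j ≤ m) :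
    (m.choose j : ℝ) * ((w : ℝ) ^ j * ((m - w : ℕ) : ℝ) ^ (m - j)) ≤
      (m.choose w : ℝ) * ((w : ℝ) ^ w * ((m - w : ℕ) : ℝ) ^ (m - w)) := by
  set a : ℕ → ℕ := fun j => m.choose j * (w ^ j * (m - w) ^ (m - j)) with ha
  suffices h : a j ≤ a w by
    simp only [ha] at h
    exact_mod_cast h
  have key : ∀ k, k < m → a (k + 1) * (k + 1) =
      (m.choose k * (w ^ k * (m - w) ^ (m - (k + 1)))) * ((m - k) * w) := by
    intro k hk
    simp only [ha]
    have := Nat.choose_succ_right_eq m k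
    calc m.choose (k + 1) * (w ^ (k + 1) * (m - w) ^ (m - (k + 1))) * (k + 1)
        = (m.choose (k + 1) * (k + 1)) * (w ^ (k + 1) * (m - w) ^ (m - (k + 1))) := by ring
      _ = _ := by rw [this]; ring
  have key' : ∀ k, k < m → a k * (k + 1) =
      (m.choose k * (w ^ k * (m - w) ^ (m - (k + 1)))) * ((k + 1) * (m - w)) := by
    intro k hk
    simp only [ha]
    rw [show m - k = (m - (k + 1)) + 1 by omega, pow_succ]
    ring
  have hup : ∀ k, k < w → a k ≤ a (k + 1) := by
    intro k hk
    refine Nat.le_of_mul_le_mul_right (c := k + 1) ?_ (Nat.succ_pos k)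
    rw [key k (by omega), key' k (by omega)]
    refine Nat.mul_le_mul_left _ ?_
    rw [mul_comm (m - k)]
    exact Nat.mul_le_mul (by omega) (by omega)
  have hdown : ∀ k, w ≤ k → k < m → a (k + 1) ≤ a k := by
    intro k hk hk'
    refine Nat.le_of_mul_le_mul_right (c := k + 1) ?_ (Nat.succ_pos k)
    rw [key k (by omega), key' k (by omega)]
    refine Nat.mul_le_mul_left _ ?_
    rw [mul_comm (m - k)]
    exact Nat.mul_le_mul (by omega) (by omega)
  rcases le_total j w with h | h
  · obtain ⟨t, rfl⟩ := Nat.exists_eq_add_of_le h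
    have : ∀ s, s ≤ t → a j ≤ a (j + s) := by
      intro s
      induction s with
      | zero => intro _; exact le_rfl
      | succ s ih => intro hs; exact (ih (by omega)).trans (hup (j + s) (by omega))
    exact this t le_rfl
  · obtain ⟨t, rfl⟩ := Nat.exists_eq_add_of_le h
    have : ∀ s, s ≤ t → a (w + s) ≤ a w := by
      intro s
      induction s with
      | zero => intro _; exact le_rfl
      | succ s ih =>
        intro hs; exact (hdown (w + s) (by omega) (by omega)).trans (ih (by omega))
    exact this t le_rfl

/-- Expanding `(w + (m - w)) ^ m` gives `m + 1` terms, of which the `w`-th is the largest. This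
replaces Stirling's formula in the entropy estimate. -/
theorem pow_le_choose_mul (m w : ℕ) (hw : w ≤ m) :
    (m : ℝ) ^ m ≤
      (m + 1) * ((m.choose w : ℝ) * ((w : ℝ) ^ w * ((m - w : ℕ) : ℝ) ^ (m - w))) := by
  have h : (m : ℝ) = (w : ℝ) + ((m - w : ℕ) : ℝ) := by
    rw [Nat.cast_sub hw]; ring
  conv_lhs => rw [h, add_pow]
  refine (Finset.sum_le_card_nsmul _ _
    ((m.choose w : ℝ) * ((w : ℝ) ^ w * ((m - w : ℕ) : ℝ) ^ (m - w))) fun j hj => ?_).trans_eq ?_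
  · rw [mul_comm]
    exact choose_mul_pow_le_mode m w hw j (by simpa [Nat.lt_succ_iff] using hj)
  · rw [Finset.card_range, nsmul_eq_mul]
    push_cast
    ring

/-- The logarithm of the size of a sphere of radius `w` in `F ^ m`, compared with the entropy. -/
theorem mul_entropy_le_logb {q : ℕ} (hq : 2 ≤ q) {m w : ℕ} (hw0 : 0 < w) (hw : w < m) :
    m * entropy q ((w : ℝ) / m) - Real.logb q (m + 1) ≤
      Real.logb q ((m.choose w : ℝ) * ((q : ℝ) - 1) ^ w) := by
  have hm : (0 : ℝ) < m := by exact_mod_cast (by omega : 0 < m)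
  have hwr : (0 : ℝ) < w := by exact_mod_cast hw0
  have hmw : (0 : ℝ) < ((m - w : ℕ) : ℝ) := by exact_mod_cast (by omega : 0 < m - w)
  have hmw' : ((m - w : ℕ) : ℝ) = m - w := Nat.cast_sub hw.le
  have hc : (0 : ℝ) < m.choose w := by exact_mod_cast Nat.choose_pos hw.le
  have hq1 : (1 : ℝ) < q := by exact_mod_cast (by omega : 1 < q)
  have hq0 : (0 : ℝ) < (q : ℝ) - 1 := by linarith
  have h := Real.log_le_log (by positivity) (pow_le_choose_mul m w hw.le)
  rw [Real.log_mul (by positivity) (by positivity), Real.log_mul (by positivity) (by positivity),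
    Real.log_mul (by positivity) (by positivity), Real.log_pow, Real.log_pow, Real.log_pow] at h
  have hL : 0 < Real.log q := Real.log_pos hq1
  have h1 : (1 : ℝ) / (1 - w / m) = m / ((m - w : ℕ) : ℝ) := by
    rw [hmw']
    have : (m : ℝ) - w ≠ 0 := by rw [← hmw']; positivity
    field_simp
  have h2 : ((q : ℝ) - 1) / (w / m) = (q - 1) * m / w := by field_simp
  unfold entropy
  rw [h1, h2]
  simp only [Real.logb]
  rw [Real.log_div (by positivity) (by positivity), Real.log_div (by positivity) (by positivity),
    Real.log_mul (by positivity) (by positivity), Real.log_mul (by positivity) (by positivity),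
    Real.log_pow]
  rw [← sub_nonneg]
  have : (↑w * Real.log (q - 1) + Real.log (m.choose w) + Real.log (m + 1)
    - (w * (Real.log (q - 1) + Real.log m - Real.log w) +
      (m - w) * (Real.log m - Real.log ((m - w : ℕ) : ℝ)))) / Real.log q ≥ 0 := by
    apply div_nonneg _ hL.le
    rw [hmw'] at h ⊢
    nlinarith
  convert this using 1
  field_simp
  ring

end Choose

/-! ### The logit function -/

section Logit

/-- The derivative of the binary entropy. -/
noncomputable def logit (y : ℝ) : ℝ := Real.log (1 - y) - Real.log y

theorem hasDerivAt_logit {y : ℝ} (h0 : 0 < y) (h1 : y < 1) :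
    HasDerivAt logit (-1 / (1 - y) - 1 / y) y := by
  have h2 : HasDerivAt (fun y : ℝ => 1 - y) (-1) y := by
    simpa using (hasDerivAt_id y).const_sub 1
  have h3 : HasDerivAt (fun y : ℝ => y) 1 y := hasDerivAt_id y
  exact (h2.log (by linarith)).sub (h3.log h0.ne')

theorem logit_one_sub (y : ℝ) : logit (1 - y) = -logit y := by
  simp [logit]

theorem logit_half : logit (1 / 2) = 0 := by
  norm_num [logit]

/-- The derivative is `-1 / (y (1 - y))`, and `y (1 - y)` increases up to `1/2`. -/
theorem strictConvexOn_logit : StrictConvexOn ℝ (Ioc (0 : ℝ) (1 / 2)) logit := by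
  apply StrictMonoOn.strictConvexOn_of_deriv (convex_Ioc _ _)
  · intro y hy
    exact (hasDerivAt_logit hy.1 (by linarith [hy.2])).continuousAt.continuousWithinAt
  · rw [interior_Ioc]
    intro a ha b hb hab
    rw [(hasDerivAt_logit ha.1 (by linarith [ha.2])).deriv,
      (hasDerivAt_logit hb.1 (by linarith [hb.2])).deriv]
    have e : ∀ y : ℝ, 0 < y → y < 1 / 2 → -1 / (1 - y) - 1 / y = -(1 / (y * (1 - y))) := by
      intro y h0 h1
      have : (1 : ℝ) - y ≠ 0 := by linarith
      field_simp
      ring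
    rw [e a ha.1 ha.2, e b hb.1 hb.2, neg_lt_neg_iff]
    have := ha.1
    have := hb.2
    apply one_div_lt_one_div_of_lt
    · apply mul_pos <;> linarith
    · nlinarith

/-- On `(p, 1/2)` the function lies strictly below the chord from `p` to `1/2`. -/
theorem logit_lt_chord {p y : ℝ} (hp : 0 < p) (hpy : p < y) (hy : y < 1 / 2) :
    logit y * (1 / 2 - p) < logit p * (1 / 2 - y) := by
  have ha : 0 < (1 / 2 - y) / (1 / 2 - p) := div_pos (by linarith) (by linarith)
  have hb : 0 < (y - p) / (1 / 2 - p) := div_pos (by linarith) (by linarith)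
  have hab : (1 / 2 - y) / (1 / 2 - p) + (y - p) / (1 / 2 - p) = 1 := by
    rw [← add_div, div_eq_one_iff_eq (by linarith)]; ring
  have hp' : p ∈ Ioc (0 : ℝ) (1 / 2) := ⟨hp, by linarith⟩
  have hhalf : (1 / 2 : ℝ) ∈ Ioc (0 : ℝ) (1 / 2) := ⟨by norm_num, le_rfl⟩
  have h := strictConvexOn_logit.2 hp' hhalf (by linarith) ha hb hab
  have hne : (1 : ℝ) / 2 - p ≠ 0 := by linarith
  have e : ((1 / 2 - y) / (1 / 2 - p)) • p + ((y - p) / (1 / 2 - p)) • (1 / 2 : ℝ) = y := by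
    simp only [smul_eq_mul]
    rw [div_mul_eq_mul_div, div_mul_eq_mul_div, ← add_div, div_eq_iff hne]
    ring
  rw [e, logit_half, smul_zero, add_zero, smul_eq_mul, div_mul_eq_mul_div,
    lt_div_iff₀ (by linarith)] at h
  linarith

/-- For `t > 1/2`, the slope of the chord to the point at `t` is monotone on `(0, 1 - t]`. -/
theorem antitoneOn_slope_logit {t : ℝ} (ht : 1 / 2 < t) :
    AntitoneOn (fun y => (logit y - logit t) / (t - y)) (Ioc 0 (1 - t)) := by
  have hneg : logit t = -logit (1 - t) := by rw [logit_one_sub]; ring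
  intro a ha b hb hab
  have ha0 := ha.1
  have hb1 := hb.2
  rcases hab.eq_or_lt with rfl | hab
  · exact le_rfl
  show (logit b - logit t) / (t - b) ≤ (logit a - logit t) / (t - a)
  rw [div_le_div_iff₀ (by linarith) (by linarith), hneg]
  -- `1 - t` lies below the chord from `a` to `1/2`, and so does `b`
  have h1 := logit_lt_chord ha0 hab (by linarith)
  have h2 : logit (1 - t) * (1 / 2 - a) < logit a * (1 / 2 - (1 - t)) :=
    logit_lt_chord ha0 (by linarith) (by linarith)
  have hpos : 0 < 1 / 2 - a := by linarith
  suffices 0 ≤ ((logit a - -logit (1 - t)) * (t - b) - (logit b - -logit (1 - t)) * (t - a)) *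
      (1 / 2 - a) by
    have := nonneg_of_mul_nonneg_left this hpos
    linarith
  -- Adding `h1` with weight `t - a` and `h2` with weight `b - a`, the terms in `logit a` combine to
  -- exactly what is needed.
  nlinarith [mul_pos (sub_pos.2 hab) (sub_pos.2 h2), mul_pos (sub_pos.2 h1) (by linarith : 0 < t - a)]

end Logit

/-! ### The entropy -/

section Entropy

variable {q : ℕ}

theorem entropy_eq_qaryEntropy (hq : 2 ≤ q) (x : ℝ) :
    entropy q x = Real.qaryEntropy q x / Real.log q := by
  have hq1 : (1 : ℝ) < q := by exact_mod_cast (by omega : 1 < q)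
  have hq0 : (q : ℝ) - 1 ≠ 0 := by linarith
  unfold entropy Real.qaryEntropy Real.binEntropy
  simp only [Real.logb]
  push_cast
  rcases eq_or_ne x 0 with rfl | hx
  · simp
  · rw [Real.log_div hq0 hx, Real.log_inv, one_div, Real.log_inv]
    ring

theorem continuous_entropy (hq : 2 ≤ q) : Continuous (entropy q) := by
  rw [funext (entropy_eq_qaryEntropy hq)]
  exact Real.qaryEntropy_continuous.div_const _

theorem hasDerivAt_entropy (hq : 2 ≤ q) {y : ℝ} (h0 : 0 < y) (h1 : y < 1) :
    HasDerivAt (entropy q) ((Real.log (q - 1) + logit y) / Real.log q) y := by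
  rw [funext (entropy_eq_qaryEntropy hq)]
  refine ((Real.hasDerivAt_qaryEntropy h0.ne' h1.ne).div_const (Real.log q)).congr_deriv ?_
  rw [logit, add_sub_assoc]

theorem entropy_zero : entropy q 0 = 0 := by simp [entropy]

theorem entropy_one : entropy q 1 = Real.log (q - 1) / Real.log q := by
  simp [entropy, Real.logb]

theorem entropy_inv (hq : 2 ≤ q) :
    entropy q (q : ℝ)⁻¹ = 1 - (1 - 2 / q) * entropy q 1 := by
  have hq1 : (1 : ℝ) < q := by exact_mod_cast (by omega : 1 < q)
  have hL : Real.log q ≠ 0 := (Real.log_pos hq1).ne'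
  have hq0 : (q : ℝ) - 1 ≠ 0 := by linarith
  have hqn : (q : ℝ) ≠ 0 := by linarith
  rw [entropy_one, entropy]
  have e : (1 : ℝ) / (1 - (q : ℝ)⁻¹) = q / (q - 1) := by field_simp
  rw [e, div_inv_eq_mul]
  simp only [Real.logb]
  rw [Real.log_div hqn hq0, Real.log_mul hq0 hqn]
  field_simp
  ring

/-- The binary part of the entropy is symmetric. -/
theorem entropy_one_sub (hq : 2 ≤ q) (y : ℝ) :
    entropy q (1 - y) = entropy q y + (1 - 2 * y) * entropy q 1 := by
  rw [entropy_eq_qaryEntropy hq, entropy_eq_qaryEntropy hq, entropy_one]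
  unfold Real.qaryEntropy
  rw [Real.binEntropy_one_sub]
  push_cast
  ring

end Entropy

section Bounds

variable {q : ℕ}

/-! ### The parameters `θ` and `(2q - 3) / (q (q - 1))` -/

theorem theta_eq (hq : 2 < q) : theta q = ((q : ℝ) - 1) / q := by
  have hq1 : (q : ℝ) ≠ 0 := by exact_mod_cast (by omega : q ≠ 0)
  unfold theta
  field_simp

theorem half_lt_theta (hq : 2 < q) : 1 / 2 < theta q := by
  have hq1 : (2 : ℝ) < q := by exact_mod_cast hq
  rw [theta_eq hq, lt_div_iff₀ (by linarith)]
  linarith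

theorem theta_pos (hq : 2 < q) : 0 < theta q := by linarith [half_lt_theta hq]

theorem theta_lt_one (hq : 2 < q) : theta q < 1 := by
  have hq1 : (0 : ℝ) < q := by exact_mod_cast (by omega : 0 < q)
  unfold theta
  linarith [inv_pos.2 hq1]

theorem one_sub_theta (q : ℕ) : 1 - theta q = (q : ℝ)⁻¹ := by simp [theta]

theorem logit_theta (hq : 2 < q) : logit (theta q) = -Real.log (q - 1) := by
  have hq1 : (2 : ℝ) < q := by exact_mod_cast hq
  rw [logit, one_sub_theta, theta_eq hq, Real.log_inv, Real.log_div (by linarith) (by linarith)]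
  ring

theorem theta_sub_crossover (hq : 2 < q) :
    theta q - crossover q = ((q : ℝ) - 2) ^ 2 / (q * (q - 1)) := by
  have hq1 : (2 : ℝ) < q := by exact_mod_cast hq
  have h1 : (q : ℝ) - 1 ≠ 0 := by linarith
  have h2 : (q : ℝ) ≠ 0 := by linarith
  rw [theta_eq hq, crossover]
  field_simp
  ring

theorem crossover_lt_theta (hq : 2 < q) : crossover q < theta q := by
  have hq1 : (2 : ℝ) < q := by exact_mod_cast hq
  rw [← sub_pos, theta_sub_crossover hq]
  have h1 : 0 < (q : ℝ) - 1 := by linarith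
  have h2 : 0 < (q : ℝ) - 2 := by linarith
  positivity

theorem crossover_pos (hq : 2 < q) : 0 < crossover q := by
  have hq1 : (2 : ℝ) < q := by exact_mod_cast hq
  have h1 : 0 < (q : ℝ) - 1 := by linarith
  have h2 : 0 < 2 * (q : ℝ) - 3 := by linarith
  unfold crossover
  positivity

/-! ### The Elias radius -/

/-- The Elias radius of relative distance `x`: the smaller solution `y` of `2y - y² / θ = x`. -/
noncomputable def eliasRadius (q : ℕ) (x : ℝ) : ℝ := theta q - √(theta q ^ 2 - x * theta q)

theorem eliasRadius_zero (hq : 2 < q) : eliasRadius q 0 = 0 := by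
  simp [eliasRadius, Real.sqrt_sq (theta_pos hq).le]

theorem eliasRadius_crossover (hq : 2 < q) : eliasRadius q (crossover q) = (q : ℝ)⁻¹ := by
  have hq1 : (2 : ℝ) < q := by exact_mod_cast hq
  have h1 : (q : ℝ) - 1 ≠ 0 := by linarith
  have h2 : (q : ℝ) ≠ 0 := by linarith
  have e : theta q ^ 2 - crossover q * theta q = (((q : ℝ) - 2) / q) ^ 2 := by
    rw [show theta q ^ 2 - crossover q * theta q = (theta q - crossover q) * theta q by ring,
      theta_sub_crossover hq, theta_eq hq]
    field_simp
  rw [eliasRadius, e, Real.sqrt_sq (div_nonneg (by linarith) (by linarith)), theta_eq hq]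
  field_simp
  ring

theorem monotone_eliasRadius (hq : 2 < q) : Monotone (eliasRadius q) := by
  intro a b hab
  unfold eliasRadius
  have := theta_pos hq
  gcongr

theorem continuous_eliasRadius (q : ℕ) : Continuous (eliasRadius q) := by
  unfold eliasRadius
  fun_prop

theorem eliasRadius_le_theta (q : ℕ) (x : ℝ) : eliasRadius q x ≤ theta q := by
  unfold eliasRadius
  linarith [Real.sqrt_nonneg (theta q ^ 2 - x * theta q)]

theorem eliasRadius_lt_theta (hq : 2 < q) {x : ℝ} (hx : x < theta q) :
    eliasRadius q x < theta q := by
  have : 0 < √(theta q ^ 2 - x * theta q) := Real.sqrt_pos.2 (by nlinarith [theta_pos hq])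
  unfold eliasRadius
  linarith

theorem eliasRadius_pos (hq : 2 < q) {x : ℝ} (hx : 0 < x) : 0 < eliasRadius q x := by
  have h := theta_pos hq
  unfold eliasRadius
  rw [sub_pos, Real.sqrt_lt' h]
  nlinarith

/-- This substitution turns functions linear in `θ - x`, such as the second piece, into quadratics
in the radius. -/
theorem theta_sub_eliasRadius_sq (hq : 2 < q) {x : ℝ} (hx : x ≤ theta q) :
    (theta q - eliasRadius q x) ^ 2 = theta q * (theta q - x) := by
  have h := theta_pos hq
  unfold eliasRadius
  rw [sub_sub_cancel, Real.sq_sqrt (by nlinarith)]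
  ring

theorem two_mul_eliasRadius_sub (hq : 2 < q) {x : ℝ} (hx : x ≤ theta q) :
    2 * eliasRadius q x - eliasRadius q x ^ 2 / theta q = x := by
  have h := theta_pos hq
  have := theta_sub_eliasRadius_sq hq hx
  field_simp
  linarith

theorem hasDerivAt_eliasRadius (hq : 2 < q) {x : ℝ} (hx : x < theta q) :
    HasDerivAt (eliasRadius q) (theta q / (2 * (theta q - eliasRadius q x))) x := by
  have h := theta_pos hq
  have h1 : HasDerivAt (fun x => theta q ^ 2 - x * theta q) (-theta q) x := by
    simpa using ((hasDerivAt_id x).mul_const (theta q)).const_sub (theta q ^ 2)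
  refine ((h1.sqrt (by nlinarith)).const_sub (theta q)).congr_deriv ?_
  unfold eliasRadius
  rw [sub_sub_cancel]
  ring

theorem eliasRadius_mem_Ioc (hq : 2 < q) {x : ℝ} (hx : 0 < x) :
    eliasRadius q (min x (crossover q)) ∈ Ioc 0 (1 - theta q) := by
  refine ⟨eliasRadius_pos hq (lt_min hx (crossover_pos hq)), ?_⟩
  rw [one_sub_theta, ← eliasRadius_crossover hq]
  exact monotone_eliasRadius hq (min_le_right _ _)

/-! ### The two pieces of the hybrid bound -/

theorem eliasBound_eq (hq : 2 < q) (x : ℝ) :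
    eliasBound q x = 1 - entropy q (eliasRadius q x) := by
  have h := theta_pos hq
  have e : theta q * √(1 - x / theta q) = √(theta q ^ 2 - x * theta q) := by
    rw [show theta q ^ 2 - x * theta q = theta q ^ 2 * (1 - x / theta q) by field_simp,
      Real.sqrt_mul (sq_nonneg _), Real.sqrt_sq h.le]
  unfold eliasBound hammingBound eliasRadius
  rw [← e]
  congr 2
  ring

/-- The line through the points of the Elias curve at the crossover and at `θ`. -/
noncomputable def hybridLine (q : ℕ) (x : ℝ) : ℝ :=
  (theta q - x) * ((q - 1) * entropy q 1 / (q - 2))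

theorem hybridLine_crossover (hq : 2 < q) :
    hybridLine q (crossover q) = 1 - entropy q (eliasRadius q (crossover q)) := by
  have hq1 : (2 : ℝ) < q := by exact_mod_cast hq
  have h1 : (q : ℝ) - 1 ≠ 0 := by linarith
  have h2 : (q : ℝ) ≠ 0 := by linarith
  have h3 : (q : ℝ) - 2 ≠ 0 := by linarith
  rw [eliasRadius_crossover hq, entropy_inv hq.le, hybridLine, theta_sub_crossover hq]
  field_simp
  ring

theorem eliasPlotkinBound_of_le {x : ℝ} (hx : x ≤ crossover q) :
    eliasPlotkinBound q x = 1 - entropy q (eliasRadius q x) := if_pos hx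

theorem eliasPlotkinBound_of_ge (hq : 2 < q) {x : ℝ} (hx : crossover q ≤ x) :
    eliasPlotkinBound q x = hybridLine q x := by
  rcases hx.eq_or_lt with rfl | hx
  · rw [hybridLine_crossover hq]
    exact eliasPlotkinBound_of_le le_rfl
  · exact if_neg hx.not_ge

theorem continuous_eliasPlotkinBound (hq : 2 < q) : Continuous (eliasPlotkinBound q) := by
  have h : eliasPlotkinBound q = fun x => if x ≤ crossover q then
      1 - entropy q (eliasRadius q x) else hybridLine q x := rfl
  rw [h]
  refine Continuous.if_le ?_ ?_ continuous_id continuous_const ?_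
  · exact continuous_const.sub ((continuous_entropy hq.le).comp (continuous_eliasRadius q))
  · unfold hybridLine
    fun_prop
  · rintro x rfl
    exact (hybridLine_crossover hq).symm

/-! ### Derivative and convexity -/

/-- The derivative of the hybrid bound on `(0, ∞)`. -/
noncomputable def hybridDeriv (q : ℕ) (x : ℝ) : ℝ :=
  -(theta q / (2 * Real.log q) *
    ((logit (eliasRadius q (min x (crossover q))) - logit (theta q)) /
      (theta q - eliasRadius q (min x (crossover q)))))

/-- By the chain rule; writing `log (q - 1)` as `-logit θ` makes the result a difference quotient of
`logit`. -/
theorem hasDerivAt_elias (hq : 2 < q) {x : ℝ} (hx0 : 0 < x) (hx : x ≤ crossover q) :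
    HasDerivAt (fun x => 1 - entropy q (eliasRadius q x)) (hybridDeriv q x) x := by
  have hx' := hx.trans_lt (crossover_lt_theta hq)
  have h1 := hasDerivAt_entropy hq.le (eliasRadius_pos hq hx0)
    ((eliasRadius_le_theta q x).trans_lt (theta_lt_one hq))
  refine ((h1.comp x (hasDerivAt_eliasRadius hq hx')).const_sub 1).congr_deriv ?_
  have h2 : theta q - eliasRadius q x ≠ 0 := (sub_pos.2 (eliasRadius_lt_theta hq hx')).ne'
  have hq1 : (2 : ℝ) < q := by exact_mod_cast hq
  have hL : Real.log q ≠ 0 := (Real.log_pos (by linarith)).ne'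
  rw [hybridDeriv, min_eq_left hx, logit_theta hq]
  field_simp
  ring

/-- Tangency at the crossover: the radius there is `1 - θ`, so oddness of `logit` makes the
numerator `2 log (q - 1)`, over the denominator `(q - 2)/q`. -/
theorem hasDerivAt_hybridLine (hq : 2 < q) {x : ℝ} (hx : crossover q ≤ x) :
    HasDerivAt (hybridLine q) (hybridDeriv q x) x := by
  have h1 : HasDerivAt (fun x => theta q - x) (-1) x := by
    simpa using (hasDerivAt_id x).const_sub (theta q)
  refine (h1.mul_const _).congr_deriv ?_
  have hq1 : (2 : ℝ) < q := by exact_mod_cast hq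
  have hL : Real.log q ≠ 0 := (Real.log_pos (by linarith)).ne'
  have h2 : (q : ℝ) ≠ 0 := by linarith
  have h3 : (q : ℝ) - 2 ≠ 0 := by linarith
  rw [hybridDeriv, min_eq_right hx, eliasRadius_crossover hq, ← one_sub_theta, logit_one_sub,
    logit_theta hq, entropy_one, show theta q - (1 - theta q) = ((q : ℝ) - 2) / q by
      rw [theta_eq hq]; field_simp; ring, theta_eq hq]
  field_simp
  ring

theorem hasDerivAt_eliasPlotkinBound (hq : 2 < q) {x : ℝ} (hx0 : 0 < x) :
    HasDerivAt (eliasPlotkinBound q) (hybridDeriv q x) x := by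
  rcases lt_trichotomy x (crossover q) with h | rfl | h
  · refine (hasDerivAt_elias hq hx0 h.le).congr_of_eventuallyEq ?_
    filter_upwards [Iio_mem_nhds h] with y hy using eliasPlotkinBound_of_le (le_of_lt hy)
  · rw [← hasDerivWithinAt_univ, ← Iic_union_Ici (a := crossover q)]
    refine HasDerivWithinAt.union ?_ ?_
    · exact (hasDerivAt_elias hq hx0 le_rfl).hasDerivWithinAt.congr
        (fun y hy => eliasPlotkinBound_of_le hy) (eliasPlotkinBound_of_le le_rfl)
    · exact (hasDerivAt_hybridLine hq le_rfl).hasDerivWithinAt.congr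
        (fun y hy => eliasPlotkinBound_of_ge hq hy) (eliasPlotkinBound_of_ge hq le_rfl)
  · refine (hasDerivAt_hybridLine hq h.le).congr_of_eventuallyEq ?_
    filter_upwards [Ioi_mem_nhds h] with y hy using eliasPlotkinBound_of_ge hq (le_of_lt hy)

theorem continuousOn_hybridDeriv (hq : 2 < q) : ContinuousOn (hybridDeriv q) (Ioi 0) := by
  have h1 : ContinuousOn (fun x => eliasRadius q (min x (crossover q))) (Ioi 0) :=
    ((continuous_eliasRadius q).comp (continuous_id.min continuous_const)).continuousOn
  have h2 : ContinuousOn (fun x => logit (eliasRadius q (min x (crossover q)))) (Ioi 0) := by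
    intro x hx
    have h := eliasRadius_mem_Ioc hq hx
    exact ContinuousAt.comp_continuousWithinAt
      (f := fun x => eliasRadius q (min x (crossover q))) (hasDerivAt_logit h.1
        (by linarith [h.2, theta_pos hq])).continuousAt (h1 x hx)
  unfold hybridDeriv
  refine (continuousOn_const.mul ((h2.sub continuousOn_const).div
    (continuousOn_const.sub h1) fun x hx => ?_)).neg
  have h := eliasRadius_mem_Ioc hq hx
  exact (sub_pos.2 (by linarith [h.2, half_lt_theta hq])).ne'

theorem monotoneOn_hybridDeriv (hq : 2 < q) : MonotoneOn (hybridDeriv q) (Ioi 0) := by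
  intro a ha b hb hab
  have hq1 : (2 : ℝ) < q := by exact_mod_cast hq
  have hL : 0 < Real.log q := Real.log_pos (by linarith)
  have hθ := theta_pos hq
  unfold hybridDeriv
  rw [neg_le_neg_iff]
  refine mul_le_mul_of_nonneg_left ?_ (by positivity)
  exact antitoneOn_slope_logit (half_lt_theta hq) (eliasRadius_mem_Ioc hq ha)
    (eliasRadius_mem_Ioc hq hb) (monotone_eliasRadius hq (min_le_min_right _ hab))

theorem convexOn_eliasPlotkinBound (hq : 2 < q) :
    ConvexOn ℝ (Icc 0 (theta q)) (eliasPlotkinBound q) := by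
  refine MonotoneOn.convexOn_of_deriv (convex_Icc _ _)
    (continuous_eliasPlotkinBound hq).continuousOn ?_ ?_
  · rw [interior_Icc]
    exact fun x hx => (hasDerivAt_eliasPlotkinBound hq hx.1).differentiableAt.differentiableWithinAt
  · rw [interior_Icc]
    intro a ha b hb hab
    rw [(hasDerivAt_eliasPlotkinBound hq ha.1).deriv, (hasDerivAt_eliasPlotkinBound hq hb.1).deriv]
    exact monotoneOn_hybridDeriv hq ha.1 hb.1 hab

/-- The line continues past `θ`, so working on an open half-line takes care of the one-sided
derivative at `θ`. -/
theorem contDiffOn_eliasPlotkinBound (hq : 2 < q) :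
    ContDiffOn ℝ 1 (eliasPlotkinBound q) (Ioi 0) := by
  rw [contDiffOn_one_iff_derivWithin isOpen_Ioi.uniqueDiffOn]
  refine ⟨fun x hx =>
    (hasDerivAt_eliasPlotkinBound hq hx).differentiableAt.differentiableWithinAt, ?_⟩
  refine (continuousOn_hybridDeriv hq).congr fun x hx => ?_
  exact (hasDerivAt_eliasPlotkinBound hq hx).hasDerivWithinAt.derivWithin
    (isOpen_Ioi.uniqueDiffOn x hx)

/-! ### Comparison with the Plotkin bound -/

theorem eliasPlotkinBound_zero (hq : 2 < q) : eliasPlotkinBound q 0 = 1 := by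
  rw [eliasPlotkinBound_of_le (crossover_pos hq).le, eliasRadius_zero hq, entropy_zero, sub_zero]

theorem eliasPlotkinBound_theta (hq : 2 < q) : eliasPlotkinBound q (theta q) = 0 := by
  rw [eliasPlotkinBound_of_ge hq (crossover_lt_theta hq).le, hybridLine, sub_self, zero_mul]

theorem eliasPlotkinBound_le_plotkinBound (hq : 2 < q) {x : ℝ} (hx : x ∈ Icc 0 (theta q)) :
    eliasPlotkinBound q x ≤ plotkinBound q x := by
  have h := theta_pos hq
  -- The Plotkin bound is the chord between the endpoint values `1` and `0`.
  have h2 := (convexOn_eliasPlotkinBound hq).2 (left_mem_Icc.2 h.le) (right_mem_Icc.2 h.le)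
    (sub_nonneg.2 ((div_le_one h).2 hx.2)) (div_nonneg hx.1 h.le) (sub_add_cancel 1 (x / theta q))
  rw [eliasPlotkinBound_zero hq, eliasPlotkinBound_theta hq] at h2
  simpa [div_mul_cancel₀ _ h.ne', plotkinBound] using h2

theorem log_lt_sub_two_add_inv {t : ℝ} (ht : 3 ≤ t) : Real.log t < t - 2 + 1 / t := by
  have h1 : Real.log t = Real.log (t / 3) + (Real.log 2 + Real.log (3 / 2)) := by
    rw [← Real.log_mul (by norm_num) (by norm_num), ← Real.log_mul (by positivity) (by norm_num)]
    congr 1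
    ring
  have h2 := Real.log_le_sub_one_of_pos (by positivity : 0 < t / 3)
  have h3 := Real.log_le_sub_one_of_pos (by norm_num : (0 : ℝ) < 3 / 2)
  have h4 := Real.log_two_lt_d9
  have h5 : 2 - 2 / 3 * t + 1 / 3 - 1 / t ≤ 0 := by
    have : 0 < t := by linarith
    have e : 2 - 2 / 3 * t + 1 / 3 - 1 / t = -((2 * t - 1) * (t - 3)) / (3 * t) := by
      field_simp
      ring
    rw [e]
    apply div_nonpos_of_nonpos_of_nonneg _ (by positivity)
    nlinarith
  linarith

theorem eliasPlotkinBound_crossover_lt (hq : 2 < q) :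
    eliasPlotkinBound q (crossover q) < plotkinBound q (crossover q) := by
  have hq1 : (3 : ℝ) ≤ q := by exact_mod_cast hq
  have hL : 0 < Real.log q := Real.log_pos (by linarith)
  have h := theta_pos hq
  have h1 : 0 < (q : ℝ) - 1 := by linarith
  have h2 : 0 < (q : ℝ) - 2 := by linarith
  rw [eliasPlotkinBound_of_ge hq le_rfl, hybridLine, plotkinBound,
    show 1 - crossover q / theta q = (theta q - crossover q) * (1 / theta q) by field_simp]
  refine mul_lt_mul_of_pos_left ?_ (sub_pos.2 (crossover_lt_theta hq))
  rw [theta_eq hq, entropy_one, one_div_div, ← mul_div_assoc, div_div,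
    div_lt_div_iff₀ (by positivity) h1]
  -- `log (q - 1) ≤ log q - 1 / q`
  have h3 : Real.log (q - 1) ≤ Real.log q - 1 / q := by
    have e : Real.log ((q - 1) / q) ≤ (q - 1) / q - 1 :=
      Real.log_le_sub_one_of_pos (by positivity)
    rw [Real.log_div (by linarith) (by linarith)] at e
    have : ((q : ℝ) - 1) / q - 1 = -(1 / q) := by field_simp; ring
    linarith
  have h4 := log_lt_sub_two_add_inv hq1
  have h5 : (q - 1) * Real.log (q - 1) * (q - 1) ≤ (q - 1) ^ 2 * (Real.log q - 1 / q) := by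
    rw [show (q - 1) * Real.log (q - 1) * (q - 1) = ((q : ℝ) - 1) ^ 2 * Real.log (q - 1) by ring]
    exact mul_le_mul_of_nonneg_left h3 (sq_nonneg _)
  have h6 : ((q : ℝ) - 1) ^ 2 * (1 / q) = q - 2 + 1 / q := by
    have : (q : ℝ) ≠ 0 := by linarith
    field_simp
    ring
  -- The claim is `(q - 1)² log (q - 1) < ((q - 1)² - 1) log q`; by `h5` and `h6` it reduces to
  -- `h4`.
  nlinarith

/-! ### Comparison with the Elias bound -/

/-- The gap between the Elias bound and the line, in terms of the Elias radius. -/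
noncomputable def eliasGap (q : ℕ) (y : ℝ) : ℝ :=
  1 - entropy q y - q / (q - 2) * entropy q 1 * (theta q - y) ^ 2

/-- The coefficient `q / (q - 2) * entropy q 1` is exactly the one for which the asymmetry of the
square cancels that of the entropy. -/
theorem eliasGap_one_sub (hq : 2 < q) (y : ℝ) : eliasGap q (1 - y) = eliasGap q y := by
  have hq1 : (2 : ℝ) < q := by exact_mod_cast hq
  have h2 : (q : ℝ) ≠ 0 := by linarith
  have h3 : (q : ℝ) - 2 ≠ 0 := by linarith
  unfold eliasGap
  rw [entropy_one_sub hq.le, theta_eq hq]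
  field_simp
  ring

theorem eliasGap_inv (hq : 2 < q) : eliasGap q (q : ℝ)⁻¹ = 0 := by
  have hq1 : (2 : ℝ) < q := by exact_mod_cast hq
  have h2 : (q : ℝ) ≠ 0 := by linarith
  have h3 : (q : ℝ) - 2 ≠ 0 := by linarith
  unfold eliasGap
  rw [entropy_inv hq.le, theta_eq hq]
  field_simp
  ring

theorem strictMonoOn_eliasGap (hq : 2 < q) :
    StrictMonoOn (eliasGap q) (Icc (q : ℝ)⁻¹ (1 / 2)) := by
  have hq1 : (2 : ℝ) < q := by exact_mod_cast hq
  have hq0 : (0 : ℝ) < (q : ℝ)⁻¹ := inv_pos.2 (by linarith)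
  have hL : 0 < Real.log q := Real.log_pos (by linarith)
  have h2 : (q : ℝ) ≠ 0 := by linarith
  have h3 : 0 < (q : ℝ) - 2 := by linarith
  refine strictMonoOn_of_deriv_pos (convex_Icc _ _) ?_ ?_
  · unfold eliasGap
    have := continuous_entropy hq.le
    fun_prop
  · rw [interior_Icc]
    intro y hy
    have d1 : HasDerivAt (fun y => theta q - y) (-1) y := by
      simpa using (hasDerivAt_id y).const_sub (theta q)
    have d2 := ((hasDerivAt_entropy hq.le (hq0.trans hy.1) (by linarith [hy.2])).const_sub 1).sub
      ((d1.pow 2).const_mul (q / (q - 2) * entropy q 1))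
    have d3 : HasDerivAt (eliasGap q) _ y := d2
    rw [d3.deriv]
    -- The derivative of the gap is a positive multiple of the distance from `logit` up to its chord
    -- over `[1/q, 1/2]`.
    have h := logit_lt_chord hq0 hy.1 hy.2
    rw [← one_sub_theta, logit_one_sub, logit_theta hq, one_sub_theta] at h
    have e1 : (1 : ℝ) / 2 - (q : ℝ)⁻¹ = (q - 2) / (2 * q) := by field_simp
    rw [e1, ← mul_div_assoc, div_lt_iff₀ (by positivity)] at h
    rw [entropy_one, theta_eq hq]
    have e2 : 0 < (-(q - 2) * logit y + (1 - 2 * y) * q * Real.log (q - 1)) /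
        ((q - 2) * Real.log q) := by
      apply div_pos _ (by positivity)
      linarith
    refine e2.trans_eq ?_
    rw [Nat.add_one_sub_one, pow_one, Nat.cast_ofNat]
    field_simp
    ring

theorem eliasGap_nonneg (hq : 2 < q) {y : ℝ} (hy : y ∈ Icc (q : ℝ)⁻¹ (theta q)) :
    0 ≤ eliasGap q y := by
  have key : ∀ y ∈ Icc (q : ℝ)⁻¹ (1 / 2), 0 ≤ eliasGap q y := fun y hy => by
    rw [← eliasGap_inv hq]
    exact (strictMonoOn_eliasGap hq).monotoneOn (left_mem_Icc.2 (hy.1.trans hy.2)) hy hy.1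
  rcases le_total y (1 / 2) with h | h
  · exact key y ⟨hy.1, h⟩
  · rw [← eliasGap_one_sub hq]
    exact key _ ⟨by rw [← one_sub_theta]; linarith [hy.2], by linarith⟩

theorem eliasBound_sub_hybridLine (hq : 2 < q) {x : ℝ} (hx : x ≤ theta q) :
    eliasBound q x - hybridLine q x = eliasGap q (eliasRadius q x) := by
  have hq1 : (2 : ℝ) < q := by exact_mod_cast hq
  have h2 : (q : ℝ) ≠ 0 := by linarith
  have h3 : (q : ℝ) - 2 ≠ 0 := by linarith
  rw [eliasBound_eq hq, eliasGap, theta_sub_eliasRadius_sq hq hx, hybridLine]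
  rw [show q / (q - 2) * entropy q 1 * (theta q * (theta q - x)) =
    (theta q - x) * ((q * theta q) * entropy q 1 / (q - 2)) by ring, theta_eq hq,
    mul_div_cancel₀ _ h2]

theorem eliasPlotkinBound_le_eliasBound (hq : 2 < q) {x : ℝ} (hx : x ∈ Icc 0 (theta q)) :
    eliasPlotkinBound q x ≤ eliasBound q x := by
  rcases le_total x (crossover q) with h | h
  · rw [eliasPlotkinBound_of_le h, eliasBound_eq hq]
  · rw [eliasPlotkinBound_of_ge hq h, ← sub_nonneg, eliasBound_sub_hybridLine hq hx.2]
    refine eliasGap_nonneg hq ⟨?_, eliasRadius_le_theta q x⟩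
    rw [← eliasRadius_crossover hq]
    exact monotone_eliasRadius hq h

theorem exists_eliasPlotkinBound_lt_eliasBound (hq : 2 < q) :
    ∃ x ∈ Icc 0 (theta q), eliasPlotkinBound q x < eliasBound q x := by
  have hq1 : (2 : ℝ) < q := by exact_mod_cast hq
  have hinv : (q : ℝ)⁻¹ < 1 / 2 := by linarith [one_sub_theta q, half_lt_theta hq]
  -- The witness is the distance whose Elias radius is `1/2`, where strict monotonicity makes the
  -- gap positive.
  obtain ⟨x, hx, hxy⟩ := intermediate_value_Icc (crossover_lt_theta hq).le
    (continuous_eliasRadius q).continuousOn (show (1 / 2 : ℝ) ∈ _ by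
      rw [eliasRadius_crossover hq]
      refine ⟨hinv.le, ?_⟩
      simpa [eliasRadius, sq] using (half_lt_theta hq).le)
  refine ⟨x, ⟨(crossover_pos hq).le.trans hx.1, hx.2⟩, ?_⟩
  rw [eliasPlotkinBound_of_ge hq hx.1, ← sub_pos, eliasBound_sub_hybridLine hq hx.2, hxy,
    ← eliasGap_inv hq]
  exact strictMonoOn_eliasGap hq (left_mem_Icc.2 hinv.le) (right_mem_Icc.2 hinv.le) hinv

end Bounds

/-! ### Bounds on the asymptotic rate -/

section Rate

variable {F : Type*} [Fintype F] [DecidableEq F]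

theorem bddAbove_codeSizes (n : ℕ) (d : ℝ) :
    BddAbove {M : ℕ | ∃ C : Finset (Fin n → F), HasMinDist C d ∧ C.card = M} := by
  refine ⟨Fintype.card F ^ n, ?_⟩
  rintro M ⟨C, -, rfl⟩
  simpa using Finset.card_le_univ C

theorem exists_card_eq_maxCodeSize (n : ℕ) (d : ℝ) :
    ∃ C : Finset (Fin n → F), HasMinDist C d ∧ C.card = maxCodeSize F n d :=
  Nat.sSup_mem (s := {M : ℕ | ∃ C : Finset (Fin n → F), HasMinDist C d ∧ C.card = M})
    ⟨0, ∅, by simp [HasMinDist], rfl⟩ (bddAbove_codeSizes n d)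

theorem one_le_maxCodeSize [Nonempty F] (n : ℕ) (d : ℝ) : 1 ≤ maxCodeSize F n d := by
  obtain ⟨f⟩ := ‹Nonempty F›
  exact le_csSup (bddAbove_codeSizes n d) ⟨{fun _ => f}, by simp [HasMinDist], by simp⟩

theorem maxCodeSize_le_pow (n : ℕ) (d : ℝ) : maxCodeSize F n d ≤ Fintype.card F ^ n := by
  obtain ⟨C, -, hC⟩ := exists_card_eq_maxCodeSize (F := F) n d
  rw [← hC]
  simpa using Finset.card_le_univ C

theorem logb_maxCodeSize_nonneg (hF : 2 < Fintype.card F) (n : ℕ) (d : ℝ) :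
    0 ≤ Real.logb (Fintype.card F) (maxCodeSize F n d) := by
  have : Nonempty F := Fintype.card_pos_iff.1 (by omega)
  exact Real.logb_nonneg (by exact_mod_cast (by omega : 1 < Fintype.card F))
    (by exact_mod_cast one_le_maxCodeSize n d)

/-- An eventual upper bound that converges bounds the asymptotic rate. -/
theorem asymptoticRate_le_of_tendsto (hF : 2 < Fintype.card F) {x b : ℝ} {v : ℕ → ℝ}
    (hv : Tendsto v atTop (𝓝 b))
    (h : ∀ᶠ n : ℕ in atTop,
      (n : ℝ)⁻¹ * Real.logb (Fintype.card F) (maxCodeSize F n (x * n)) ≤ v n) :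
    asymptoticRate F x ≤ b := by
  rw [← hv.limsup_eq]
  refine limsup_le_limsup h ?_ hv.isBoundedUnder_le
  -- A real `limsup` is monotone only under boundedness conditions; the lower bound `0` provides the
  -- one needed here.
  refine IsBoundedUnder.isCoboundedUnder_le ⟨0, ?_⟩
  rw [eventually_map]
  exact Eventually.of_forall fun n =>
    mul_nonneg (by positivity) (logb_maxCodeSize_nonneg hF _ _)

theorem asymptoticRate_le_one (hF : 2 < Fintype.card F) (x : ℝ) : asymptoticRate F x ≤ 1 := by
  have : Nonempty F := Fintype.card_pos_iff.1 (by omega)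
  have hq : (1 : ℝ) < Fintype.card F := by exact_mod_cast (by omega : 1 < Fintype.card F)
  refine asymptoticRate_le_of_tendsto hF tendsto_const_nhds ?_
  filter_upwards [eventually_gt_atTop 0] with n hn
  have hn' : (0 : ℝ) < n := by exact_mod_cast hn
  rw [inv_mul_le_iff₀ hn', mul_one, Real.logb_le_iff_le_rpow hq
    (by exact_mod_cast one_le_maxCodeSize n _), Real.rpow_natCast]
  exact_mod_cast maxCodeSize_le_pow n _

theorem logb_maxCodeSize_le (hF : 2 < Fintype.card F) {n m w : ℕ} (hmn : m ≤ n) (hw0 : 0 < w)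
    (hw : w < m) {x ε : ℝ} (hx : 0 < x) (hε : 0 < ε)
    (h : 2 * w - (w : ℝ) ^ 2 / (m * theta (Fintype.card F)) +
      (n - m) * theta (Fintype.card F) ≤ (x - ε) * n) :
    Real.logb (Fintype.card F) (maxCodeSize F n (x * n)) ≤
      m - m * entropy (Fintype.card F) ((w : ℝ) / m) + Real.logb (Fintype.card F) (n + 1) +
        Real.logb (Fintype.card F) (x / ε) := by
  have : Nonempty F := Fintype.card_pos_iff.1 (by omega)
  have hq : (2 : ℝ) < Fintype.card F := by exact_mod_cast hF
  have hq1 : (1 : ℝ) < Fintype.card F := by linarith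
  have hn : (0 : ℝ) < n := by exact_mod_cast (by omega : 0 < n)
  obtain ⟨C, hC, hCc⟩ := exists_card_eq_maxCodeSize (F := F) n (x * n)
  obtain ⟨T, -, hT⟩ := Finset.exists_subset_card_eq (s := (Finset.univ : Finset (Fin n)))
    (n := m) (by simpa using hmn)
  -- The distance `x n` exceeds the mean by at least `ε n`, so `x / ε` bounds the code in each
  -- anticode, independently of `n`.
  have h1 := card_mul_choose_le (F := F) (by omega) T w C (B := x / ε) (by positivity) hC
  rw [hT, Fintype.card_fin] at h1
  have hgap : ε * n ≤ x * n - (2 * w - (w : ℝ) ^ 2 / (m * theta (Fintype.card F)) +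
      (n - m) * theta (Fintype.card F)) := by linarith
  have h2 := h1 (by
    refine le_trans (le_of_eq ?_) (mul_le_mul_of_nonneg_left hgap (by positivity))
    field_simp) ((by positivity : 0 < ε * n).trans_le hgap)
  rw [hCc] at h2
  have hA : (0 : ℝ) < maxCodeSize F n (x * n) := by
    exact_mod_cast one_le_maxCodeSize n _
  have hc : (0 : ℝ) < m.choose w := by exact_mod_cast Nat.choose_pos hw.le
  have hs : 0 < (m.choose w : ℝ) * ((Fintype.card F : ℝ) - 1) ^ w := by
    have : 0 < (Fintype.card F : ℝ) - 1 := by linarith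
    positivity
  have h3 := Real.logb_le_logb_of_le hq1 (by positivity) h2
  rw [Real.logb_mul hA.ne' hs.ne', Real.logb_mul (pow_pos (by linarith) m).ne'
    (by positivity), Real.logb_pow, Real.logb_self_eq_one hq1, mul_one] at h3
  have h4 := mul_entropy_le_logb hF.le hw0 hw
  have h5 : Real.logb (Fintype.card F) ((m : ℝ) + 1) ≤ Real.logb (Fintype.card F) ((n : ℝ) + 1) :=
    Real.logb_le_logb_of_le hq1 (by positivity) (by gcongr)
  linarith

theorem asymptoticRate_le_of_lt (hF : 2 < Fintype.card F) {ω μ x : ℝ} (hω0 : 0 < ω) (hω1 : ω < 1)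
    (hμ0 : 0 < μ) (hμ1 : μ ≤ 1) (hx : 0 < x)
    (h : μ * (2 * ω - ω ^ 2 / theta (Fintype.card F)) + (1 - μ) * theta (Fintype.card F) < x) :
    asymptoticRate F x ≤ μ * (1 - entropy (Fintype.card F) ω) := by
  set q := Fintype.card F with hq
  set m : ℕ → ℕ := fun n => ⌊μ * (n : ℝ)⌋₊ with hm
  set w : ℕ → ℕ := fun n => ⌊ω * (m n : ℝ)⌋₊ with hw
  have hm_lim : Tendsto (fun n => (m n : ℝ) / n) atTop (𝓝 μ) :=
    (tendsto_nat_floor_mul_div_atTop hμ0.le).comp tendsto_natCast_atTop_atTop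
  have hm_top : Tendsto m atTop atTop :=
    tendsto_nat_floor_atTop.comp (tendsto_natCast_atTop_atTop.const_mul_atTop hμ0)
  have hw_lim : Tendsto (fun n => (w n : ℝ) / m n) atTop (𝓝 ω) :=
    ((tendsto_nat_floor_mul_div_atTop hω0.le).comp tendsto_natCast_atTop_atTop).comp hm_top
  have hw_top : Tendsto w atTop atTop :=
    tendsto_nat_floor_atTop.comp
      ((tendsto_natCast_atTop_atTop.comp hm_top).const_mul_atTop hω0)
  have hlog : Tendsto (fun n : ℕ => (n : ℝ)⁻¹ * Real.logb q (n + 1)) atTop (𝓝 0) := by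
    have h1 := (Real.tendsto_pow_log_div_mul_add_atTop 1 (-1) 1 one_ne_zero).comp
      (tendsto_atTop_add_const_right _ (1 : ℝ) (tendsto_natCast_atTop_atTop (R := ℝ)))
    have h2 := h1.div_const (Real.log q)
    rw [zero_div] at h2
    refine h2.congr fun n => ?_
    simp only [Function.comp_apply, pow_one, Real.logb]
    rw [show (1 : ℝ) * (n + 1) + -1 = n by ring]
    ring
  -- The strict inequality leaves room for `ε = x - y` and for the rounding in `m` and `w`.
  obtain ⟨y, hy1, hy2⟩ := exists_between h
  have hε : 0 < x - y := sub_pos.2 hy2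
  have hinv : Tendsto (fun n : ℕ => (n : ℝ)⁻¹) atTop (𝓝 0) :=
    tendsto_inv_atTop_zero.comp tendsto_natCast_atTop_atTop
  have hv : Tendsto (fun n : ℕ => (m n : ℝ) / n * (1 - entropy q ((w n : ℝ) / m n)) +
      (n : ℝ)⁻¹ * Real.logb q (n + 1) + (n : ℝ)⁻¹ * Real.logb q (x / (x - y))) atTop
      (𝓝 (μ * (1 - entropy q ω) + 0 + 0 * Real.logb q (x / (x - y)))) :=
    ((hm_lim.mul ((((continuous_entropy hF.le).tendsto ω).comp hw_lim).const_sub 1)).add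
      hlog).add (hinv.mul_const _)
  rw [zero_mul, add_zero, add_zero] at hv
  refine asymptoticRate_le_of_tendsto hF hv ?_
  have hD : Tendsto (fun n : ℕ => (m n : ℝ) / n * (2 * ((w n : ℝ) / m n) -
      ((w n : ℝ) / m n) ^ 2 / theta q) + (1 - (m n : ℝ) / n) * theta q) atTop
      (𝓝 (μ * (2 * ω - ω ^ 2 / theta q) + (1 - μ) * theta q)) :=
    (hm_lim.mul ((hw_lim.const_mul 2).sub ((hw_lim.pow 2).div_const _))).add
      ((hm_lim.const_sub 1).mul_const _)
  filter_upwards [eventually_gt_atTop 0, hw_top.eventually_gt_atTop 0,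
    hm_top.eventually_gt_atTop 0, hD.eventually_lt_const hy1] with n hn hwn hmn hDn
  have hn' : (0 : ℝ) < n := by exact_mod_cast hn
  have hm' : (0 : ℝ) < m n := by exact_mod_cast hmn
  have hle : m n ≤ n := by
    refine Nat.floor_le_of_le ?_
    nlinarith
  have hlt : w n < m n := by
    rw [hw, Nat.floor_lt (by positivity)]
    nlinarith
  have key := logb_maxCodeSize_le hF hle hwn hlt hx hε (by
    have e : (2 * w n - (w n : ℝ) ^ 2 / (m n * theta q) + (n - m n) * theta q) =
        ((m n : ℝ) / n * (2 * ((w n : ℝ) / m n) - ((w n : ℝ) / m n) ^ 2 / theta q) +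
          (1 - (m n : ℝ) / n) * theta q) * n := by
      have := theta_pos hF
      field_simp
    rw [e, sub_sub_cancel]
    exact mul_le_mul_of_nonneg_right hDn.le hn'.le)
  rw [inv_mul_le_iff₀ hn']
  refine key.trans_eq ?_
  rw [← hq]
  field_simp

/-- Since `2ω - ω²/θ` is strictly increasing below `θ`, any `ω' < ω` satisfies the strict condition;
then `ω'` tends to `ω`. -/
theorem asymptoticRate_le (hF : 2 < Fintype.card F) {ω μ x : ℝ} (hω0 : 0 < ω)
    (hω1 : ω < theta (Fintype.card F)) (hμ0 : 0 < μ) (hμ1 : μ ≤ 1) (hx : 0 < x)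
    (h : μ * (2 * ω - ω ^ 2 / theta (Fintype.card F)) + (1 - μ) * theta (Fintype.card F) ≤ x) :
    asymptoticRate F x ≤ μ * (1 - entropy (Fintype.card F) ω) := by
  have hθ := theta_pos hF
  have hlim : Tendsto (fun ω => μ * (1 - entropy (Fintype.card F) ω)) (𝓝[<] ω)
      (𝓝 (μ * (1 - entropy (Fintype.card F) ω))) := by
    have := continuous_entropy hF.le
    exact (Continuous.tendsto (by fun_prop) ω).mono_left nhdsWithin_le_nhds
  refine ge_of_tendsto hlim ?_
  filter_upwards [Ioo_mem_nhdsLT hω0] with ω' hω'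
  refine asymptoticRate_le_of_lt hF hω'.1 (by linarith [hω'.2, theta_lt_one hF]) hμ0 hμ1 hx
    (lt_of_lt_of_le ?_ h)
  refine (add_lt_add_iff_right _).2 (mul_lt_mul_of_pos_left ?_ hμ0)
  rw [← sub_pos]
  have e : 2 * ω - ω ^ 2 / theta (Fintype.card F) - (2 * ω' - ω' ^ 2 / theta (Fintype.card F)) =
      (ω - ω') * (2 * theta (Fintype.card F) - ω - ω') / theta (Fintype.card F) := by
    field_simp
    ring
  rw [e]
  exact div_pos (mul_pos (sub_pos.2 hω'.2) (by linarith [hω'.2])) hθ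

theorem asymptoticRate_le_eliasPlotkinBound (hF : 2 < Fintype.card F) {x : ℝ}
    (hx : x ∈ Icc 0 (theta (Fintype.card F))) :
    asymptoticRate F x ≤ eliasPlotkinBound (Fintype.card F) x := by
  set q := Fintype.card F with hq
  have hθ := theta_pos hF
  have hq1 : (2 : ℝ) < q := by exact_mod_cast hF
  have hinv : 0 < (q : ℝ)⁻¹ := inv_pos.2 (by linarith)
  have hinv' : (q : ℝ)⁻¹ < theta q := by linarith [one_sub_theta q, half_lt_theta hF]
  have hcross : 2 * (q : ℝ)⁻¹ - (q : ℝ)⁻¹ ^ 2 / theta q = crossover q := by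
    rw [← eliasRadius_crossover hF]
    exact two_mul_eliasRadius_sub hF (crossover_lt_theta hF).le
  have hval : 1 - entropy q (q : ℝ)⁻¹ = hybridLine q (crossover q) := by
    rw [hybridLine_crossover hF, eliasRadius_crossover hF]
  have hc := sub_pos.2 (crossover_lt_theta hF)
  rcases hx.1.eq_or_lt with rfl | hx0
  · rw [eliasPlotkinBound_zero hF]
    exact asymptoticRate_le_one hF 0
  rcases le_total x (crossover q) with hxc | hxc
  · rw [eliasPlotkinBound_of_le hxc, ← one_mul (1 - _)]
    refine asymptoticRate_le hF (eliasRadius_pos hF hx0)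
      (eliasRadius_lt_theta hF (hxc.trans_lt (crossover_lt_theta hF))) one_pos le_rfl hx0 ?_
    rw [two_mul_eliasRadius_sub hF hx.2]
    linarith
  -- At `x = θ` the choice of `μ` below would be `0`, which is not admissible; instead `μ` tends to
  -- `0` from the right.
  rcases hx.2.eq_or_lt with rfl | hxθ
  · rw [eliasPlotkinBound_theta hF]
    have hlim : Tendsto (fun μ : ℝ => μ * (1 - entropy q (q : ℝ)⁻¹)) (𝓝[>] 0)
        (𝓝 (0 * (1 - entropy q (q : ℝ)⁻¹))) :=
      (Continuous.tendsto (by fun_prop) 0).mono_left nhdsWithin_le_nhds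
    rw [zero_mul] at hlim
    refine ge_of_tendsto hlim ?_
    filter_upwards [Ioo_mem_nhdsGT (zero_lt_one' ℝ)] with μ hμ
    refine asymptoticRate_le hF hinv hinv' hμ.1 hμ.2.le hθ ?_
    rw [hcross]
    nlinarith [hμ.1]
  -- This `μ` solves `μ * crossover q + (1 - μ) * theta q = x`.
  · have hμ : (theta q - x) / (theta q - crossover q) * (theta q - crossover q) = theta q - x :=
      div_mul_cancel₀ _ hc.ne'
    have e : eliasPlotkinBound q x =
        (theta q - x) / (theta q - crossover q) * (1 - entropy q (q : ℝ)⁻¹) := by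
      rw [eliasPlotkinBound_of_ge hF hxc, hval, hybridLine, hybridLine, ← mul_assoc, hμ]
    rw [e]
    refine asymptoticRate_le hF hinv hinv' (div_pos (sub_pos.2 hxθ) hc)
      ((div_le_one hc).2 (by linarith)) hx0 ?_
    rw [hcross]
    linarith

end Rate

/-- The hybrid Elias-Plotkin bound. -/
theorem theorem2 {q : ℕ} (hq : 2 < q) {F : Type*} [Fintype F] [DecidableEq F]
    (hF : Fintype.card F = q) :
    -- the two defining formulas hold on closed intervals with a common endpoint
    (∀ x ∈ Icc 0 (crossover q),
      eliasPlotkinBound q x = 1 - entropy q (theta q - √(theta q ^ 2 - x * theta q))) ∧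
    (∀ x ∈ Icc (crossover q) (theta q),
      eliasPlotkinBound q x = (theta q - x) * ((q - 1) * entropy q 1 / (q - 2))) ∧
    -- it is an upper bound for the asymptotic rate
    (∀ x ∈ Icc 0 (theta q), asymptoticRate F x ≤ eliasPlotkinBound q x) ∧
    -- it improves the Elias bound
    (∀ x ∈ Icc 0 (theta q), eliasPlotkinBound q x ≤ eliasBound q x) ∧
    (∃ x ∈ Icc 0 (theta q), eliasPlotkinBound q x < eliasBound q x) ∧
    -- it improves the Plotkin bound
    (∀ x ∈ Icc 0 (theta q), eliasPlotkinBound q x ≤ plotkinBound q x) ∧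
    (∃ x ∈ Icc 0 (theta q), eliasPlotkinBound q x < plotkinBound q x) ∧
    -- it is convex, continuous, and continuously differentiable away from `0`
    ConvexOn ℝ (Icc 0 (theta q)) (eliasPlotkinBound q) ∧
    ContinuousOn (eliasPlotkinBound q) (Icc 0 (theta q)) ∧
    ContDiffOn ℝ 1 (eliasPlotkinBound q) (Ioc 0 (theta q)) := by
  subst hF
  exact ⟨fun x hx => eliasPlotkinBound_of_le hx.2, fun x hx => eliasPlotkinBound_of_ge hq hx.1,
    fun x hx => asymptoticRate_le_eliasPlotkinBound hq hx,
    fun x hx => eliasPlotkinBound_le_eliasBound hq hx, exists_eliasPlotkinBound_lt_eliasBound hq,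
    fun x hx => eliasPlotkinBound_le_plotkinBound hq hx,
    ⟨crossover _, ⟨(crossover_pos hq).le, (crossover_lt_theta hq).le⟩,
      eliasPlotkinBound_crossover_lt hq⟩,
    convexOn_eliasPlotkinBound hq, (continuous_eliasPlotkinBound hq).continuousOn,
    (contDiffOn_eliasPlotkinBound hq).mono Ioc_subset_Ioi_self⟩
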